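/- **Setting.** Let $\iota : H \hookrightarrow G$ be a closed immersion of unimodular locally profinite groups (regard $H$ as a closed subgroup of $G$). Let $\Upsilon_H,\Upsilon_G$ be non-empty collections of compact open subgroups of $H$, $G$ such that $\{K'\cap H : K'\in\Upsilon_G\}\subset\Upsilon_H$ and each collection $\Upsilon$ satisfies: (T1) $\Upsilon$ is stable under conjugation; (T2) for $K_1,K_2\in\Upsilon$ there is $K_3\in\Upsilon$ with $K_3\triangleleft K_1$ and $K_3\subset K_2$; (T3) $\Upsilon$ is stable under pairwise intersection. Let $\mathcal O$ be an integral domain whose field of fractions is a $\mathbb Q$-algebra, and let $\Phi$ be a field containing $\mathcal O$. Let $K, L\in\Upsilon_G$ with $L\triangleleft K$, and put $U=K\cap H$. Let $\mathfrak H\in\mathcal C_{\mathcal O}(K\backslash G/K)$ be a non-zero element, i.e. a non-zero compactly supported $K$-bi-invariant function $G\to\mathcal O$. **Functors.** An RIC functor $M$ on $(H,\Upsilon_H)$ with values in $\mathcal O$-modules assigns to each $V\in\Upsilon_H$ an $\mathcal O$-module $M(V)$ and to each $h\in H$ and $V,W\in\Upsilon_H$ with $h^{-1}Vh\subset W$ a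 pullback $[h]^*:M(W)\to M(V)$ and a pushforward $[h]_*:M(V)\to M(W)$. These are respectively contravariantly and covariantly functorial for the composition $(V\xrightarrow{h}W)\circ(V'\xrightarrow{h'}V)=(V'\xrightarrow{h'h}W)$, they satisfy $[h]^*=[h^{-1}]_*$ when $h^{-1}Vh=W$, and $[\gamma]_*:M(V)\to M(V)$ is the identity for $\gamma\in V$. The *trivial functor* has $M(V)=\mathcal O$ for all $V$, all pullbacks equal to the identity, and $[h]_*:M(V)\to M(W)$ equal to multiplication by $[W:h^{-1}Vh]$. For any such $M$, let $M_\Phi=M\otimes_{\mathcal O}\Phi$ and let $\widehat M_\Phi=\varinjlim_{V}M_\Phi(V)$ be the direct limit over the pullbacks $[1]^*$. Let $j_V:M(V)\to\widehat M_\Phi$ be the natural map. The group $H$ acts on $\widehat M_\Phi$: the action of $h$ is induced by the maps $[h]^*:M_\Phi(V)\to M_\Phi(hVh^{-1})$. **Zeta elements.** Let $\mathcal C(G/K,\widehat M_\Phi)$ be the space of compactly supported functions $\xi:G\to\widehat M_\Phi$ that are invariant under right translation by $K$, with the $H$-action $(h\xi)(g)=h\,\xi(h^{-1}g)$. For compact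 open $V_1,V_2\subset H$ put $[V_1:V_2]=\mu_H(V_1)/\mu_H(V_2)\in\mathbb Q$, where $\mu_H$ is a Haar measure on $H$. For $x_U\in M(U)$, a *zeta element* for $(x_U,\mathfrak H,L)$ with coefficients in $\Phi$ is an element $\zeta\in\mathcal C(G/K,\widehat M_\Phi)$ such that 1. ($\mathcal O$-integrality at level $L$) for every $g\in G$ there are finitely many $V_i\in\Upsilon_H$ with $V_i\subset gLg^{-1}$ and elements $x_{V_i}\in M(V_i)$ such that $\zeta(g)=\sum_i[U:V_i]\,j_{V_i}(x_{V_i})$; 2. $\zeta$ and the function $g\mapsto\mathfrak H(g)\,j_U(x_U)$ have the same class in the space of $H$-coinvariants of $\mathcal C(G/K,\widehat M_\Phi)$. **Degrees.** For each $\alpha\in H\backslash H\cdot\mathrm{supp}(\mathfrak H)/K$ choose a representative $g_\alpha\in G$ and put $H_\alpha=H\cap g_\alpha Kg_\alpha^{-1}$, $V_\alpha=H\cap g_\alpha Lg_\alpha^{-1}$, $d_\alpha=[H_\alpha:V_\alpha]$. Let $\mathfrak h_\alpha\in\mathcal C_{\mathcal O}(U\backslash H/H_\alpha)$ be the function $h\mapsto\mathfrak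 H(hg_\alpha)$ and let $\mathfrak h_\alpha^t\in\mathcal C_{\mathcal O}(H_\alpha\backslash H/U)$ be its transpose $h\mapsto\mathfrak h_\alpha(h^{-1})$. The degree $\deg:\mathcal C_{\mathcal O}(H_\alpha\backslash H/U)\to\mathcal O$ is the $\mathcal O$-linear map sending the characteristic function of a double coset $H_\alpha\sigma U$ to $|H_\alpha\sigma U/U|$. **Corollary.** Let $M$ be the trivial functor on $(H,\Upsilon_H)$ and let $x_U\in M(U)=\mathcal O$ be an invertible element. Then, for any choice of the representatives $g_\alpha$, a zeta element for $(x_U,\mathfrak H,L)$ with coefficients in $\Phi$ exists if and only if $$\deg(\mathfrak h_\alpha^t)\in d_\alpha\,\mathcal O\qquad\text{for all }\alpha\in H\backslash H\cdot\mathrm{supp}(\mathfrak H)/K .$$ -/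

import Mathlib

open scoped Pointwise TensorProduct

namespace ZetaElement

universe u v w

/-! ### Locally profinite groups and levels -/

/-- A locally profinite group: a locally compact, totally disconnected Hausdorff topological
group. -/
class LocallyProfinite (G : Type*) [Group G] [TopologicalSpace G] : Prop extends
    IsTopologicalGroup G, LocallyCompactSpace G, TotallyDisconnectedSpace G, T2Space G

/-- A locally compact group is unimodular if its modular character is trivial, i.e. if its left
Haar measures are right invariant. -/
def IsUnimodular (G : Type*) [Group G] [TopologicalSpace G] [IsTopologicalGroup G]
    [LocallyCompactSpace G] : Prop :=
  ∀ g : G, MeasureTheory.Measure.modularCharacterFun g = 1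

/-- A non-empty collection `Υ` of compact open subgroups of `G` satisfying the axioms
(T1) stability under conjugation, (T2) existence of small normal subgroups and
(T3) stability under intersection.  Here `MulAut.conj g • K` is `g K g⁻¹`. -/
structure LevelFamily (G : Type u) [Group G] [TopologicalSpace G] where
  carrier : Set (Subgroup G)
  nonempty : carrier.Nonempty
  isOpen : ∀ K ∈ carrier, IsOpen (K : Set G)
  isCompact : ∀ K ∈ carrier, IsCompact (K : Set G)
  conj_mem : ∀ (g : G), ∀ K ∈ carrier, MulAut.conj g • K ∈ carrier
  exists_normal : ∀ K ∈ carrier, ∀ L ∈ carrier,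
    ∃ K' ∈ carrier, K' ≤ K ∧ (K'.subgroupOf K).Normal ∧ K' ≤ L
  inf_mem : ∀ K ∈ carrier, ∀ L ∈ carrier, K ⊓ L ∈ carrier

/-- The type of members of the collection `Υ`. -/
abbrev LevelFamily.Level {G : Type u} [Group G] [TopologicalSpace G] (Υ : LevelFamily G) :
    Type u :=
  {K : Subgroup G // K ∈ Υ.carrier}

/-- The level `g K g⁻¹`. -/
abbrev LevelFamily.conj {G : Type u} [Group G] [TopologicalSpace G] (Υ : LevelFamily G)
    (g : G) (K : Υ.Level) : Υ.Level :=
  ⟨MulAut.conj g • K.1, Υ.conj_mem g K.1 K.2⟩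

/-- `g` defines a morphism `L → K` in the category of compact opens: `g⁻¹ L g ⊆ K`. -/
def IsMor {G : Type u} [Group G] (g : G) (L K : Subgroup G) : Prop :=
  MulAut.conj g⁻¹ • L ≤ K

theorem IsMor.one {G : Type u} [Group G] {L K : Subgroup G} (h : L ≤ K) : IsMor 1 L K := by
  simpa [IsMor] using h

theorem IsMor.comp {G : Type u} [Group G] {g h : G} {L' L K : Subgroup G}
    (hh : IsMor h L' L) (hg : IsMor g L K) : IsMor (h * g) L' K := by
  unfold IsMor at *
  rw [mul_inv_rev, map_mul, mul_smul]
  exact (Subgroup.pointwise_smul_le_pointwise_smul_iff.2 hh).trans hg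

theorem IsMor.inv {G : Type u} [Group G] {g : G} {L K : Subgroup G}
    (h : MulAut.conj g⁻¹ • L = K) : IsMor g⁻¹ K L := by
  unfold IsMor
  rw [← h, smul_smul, ← map_mul]
  simp

theorem IsMor.conj {G : Type u} [Group G] (g : G) (K : Subgroup G) :
    IsMor g (MulAut.conj g • K) K := by
  unfold IsMor
  rw [smul_smul, ← map_mul]
  simp

theorem IsMor.le_conj {G : Type u} [Group G] {g : G} {L K : Subgroup G}
    (h : IsMor g L K) : L ≤ MulAut.conj g • K := by
  have h' := Subgroup.pointwise_smul_le_pointwise_smul_iff (a := MulAut.conj g).2 h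
  rw [smul_smul, ← map_mul] at h'
  simpa using h'

/-! ### RIC functors -/

section RIC

variable {G : Type u} [Group G] [TopologicalSpace G]

/-- An RIC (restriction, induction, conjugation) functor on `(G, Υ)` valued in `R`-modules:
a contravariant functor `pull` (`[g]^*`) and a covariant functor `push` (`[g]_*`) on the category
of compact opens (objects: members of `Υ`; morphisms `L → K`: elements `g` with `g⁻¹ L g ⊆ K`;
composition `(L →[g] K) ∘ (L' →[h] L) = (L' →[h g] K)`), with the same values on objects, such that
`[g]^* = [g⁻¹]_*` whenever `g⁻¹ L g = K`, and `[γ]_{K,K,*} = id` for `γ ∈ K`. -/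
structure RICFunctor (R : Type v) [CommRing R] (Υ : LevelFamily G) where
  obj : Υ.Level → Type w
  [addCommGroup : ∀ K, AddCommGroup (obj K)]
  [module : ∀ K, Module R (obj K)]
  pull : ∀ (g : G) (L K : Υ.Level), IsMor g L.1 K.1 → (obj K →ₗ[R] obj L)
  push : ∀ (g : G) (L K : Υ.Level), IsMor g L.1 K.1 → (obj L →ₗ[R] obj K)
  pull_one : ∀ (K : Υ.Level) (x : obj K), pull 1 K K (IsMor.one le_rfl) x = x
  pull_comp : ∀ (g h : G) (L' L K : Υ.Level) (hh : IsMor h L'.1 L.1) (hg : IsMor g L.1 K.1)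
    (x : obj K), pull h L' L hh (pull g L K hg x) = pull (h * g) L' K (hh.comp hg) x
  push_comp : ∀ (g h : G) (L' L K : Υ.Level) (hh : IsMor h L'.1 L.1) (hg : IsMor g L.1 K.1)
    (x : obj L'), push g L K hg (push h L' L hh x) = push (h * g) L' K (hh.comp hg) x
  pull_eq_push : ∀ (g : G) (L K : Υ.Level) (h : MulAut.conj g⁻¹ • L.1 = K.1),
    pull g L K h.le = push g⁻¹ K L (IsMor.inv h)
  push_of_mem : ∀ (γ : G) (K : Υ.Level) (h : IsMor γ K.1 K.1), γ ∈ K.1 →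
    ∀ x : obj K, push γ K K h x = x

attribute [instance] RICFunctor.addCommGroup RICFunctor.module

/-- The trivial functor: the RIC functor `K ↦ π^K` attached to the trivial representation `π = R`.
Thus every level is sent to `R`, the pullbacks `x ↦ g · x` are the identity and the pushforward
`x ↦ ∑_{γ ∈ K / g⁻¹Lg} γ g⁻¹ · x` along `g : L → K` is multiplication by `[K : g⁻¹ L g]`. -/
noncomputable def trivialFunctor (R : Type v) [CommRing R] (Υ : LevelFamily G) :
    RICFunctor.{u, v, v} R Υ where
  obj _ := R
  pull _ _ _ _ := LinearMap.id
  push g L K _ := (((MulAut.conj g⁻¹ • L.1).relIndex K.1 : ℕ) : R) • LinearMap.id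
  pull_one _ _ := rfl
  pull_comp _ _ _ _ _ _ _ _ := rfl
  push_comp g h L' L K hh hg x := by
    simp only [LinearMap.smul_apply, LinearMap.id_apply, smul_eq_mul]
    rw [← mul_assoc, ← Nat.cast_mul]
    congr 2
    have h1 : MulAut.conj (h * g)⁻¹ • L'.1 = MulAut.conj g⁻¹ • (MulAut.conj h⁻¹ • L'.1) := by
      rw [mul_inv_rev, map_mul, mul_smul]
    have h2 : MulAut.conj g⁻¹ • (MulAut.conj h⁻¹ • L'.1) ≤ MulAut.conj g⁻¹ • L.1 :=
      Subgroup.pointwise_smul_le_pointwise_smul_iff.2 hh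
    rw [h1, ← Subgroup.relIndex_mul_relIndex _ _ _ h2 hg, Subgroup.relIndex_pointwise_smul,
      mul_comm]
  pull_eq_push g L K h := by
    ext
    have : (MulAut.conj g • K.1) = L.1 := by
      rw [← h, smul_smul, ← map_mul]; simp
    simp [this]
  push_of_mem γ K h hγ x := by
    have : MulAut.conj γ⁻¹ • K.1 = K.1 := Subgroup.conj_smul_eq_self_of_mem (inv_mem hγ)
    rw [this]
    simp

variable {R : Type v} [CommRing R] {Υ : LevelFamily G}

/-- Extension of scalars `K ↦ S ⊗ M(K)` of an RIC functor. -/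
noncomputable def RICFunctor.baseChange (M : RICFunctor.{u, v, w} R Υ) (S : Type*) [CommRing S]
    [Algebra R S] : RICFunctor S Υ where
  obj K := S ⊗[R] M.obj K
  pull g L K h := (M.pull g L K h).baseChange S
  push g L K h := (M.push g L K h).baseChange S
  pull_one K x := by
    have : M.pull 1 K K (IsMor.one le_rfl) = LinearMap.id := LinearMap.ext (M.pull_one K)
    rw [this, LinearMap.baseChange_id]; rfl
  pull_comp g h L' L K hh hg x := by
    rw [← LinearMap.comp_apply, ← LinearMap.baseChange_comp]
    congr 2
    exact LinearMap.ext (M.pull_comp g h L' L K hh hg)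
  push_comp g h L' L K hh hg x := by
    rw [← LinearMap.comp_apply, ← LinearMap.baseChange_comp]
    congr 2
    exact LinearMap.ext (M.push_comp g h L' L K hh hg)
  pull_eq_push g L K h := by rw [M.pull_eq_push g L K h]
  push_of_mem γ K h hγ x := by
    have : M.push γ K K h = LinearMap.id := LinearMap.ext (M.push_of_mem γ K h hγ)
    rw [this, LinearMap.baseChange_id]; rfl

/-! ### Inductive completions -/

open Classical in
/-- The inductive completion `colim_{K ∈ Υ} M(K)`, taken over all restriction maps. -/
abbrev RICFunctor.Completion (M : RICFunctor.{u, v, w} R Υ) : Type (max u w) :=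
  Module.DirectLimit (ι := Υ.Levelᵒᵈ) (fun K => M.obj (OrderDual.ofDual K))
    (fun K L h => M.pull 1 (OrderDual.ofDual L) (OrderDual.ofDual K) (IsMor.one h))

open Classical in
/-- The natural map `j_K : M(K) → colim M`. -/
noncomputable def RICFunctor.toCompletion (M : RICFunctor.{u, v, w} R Υ) (K : Υ.Level) :
    M.obj K →ₗ[R] M.Completion :=
  Module.DirectLimit.of R Υ.Levelᵒᵈ (fun K => M.obj (OrderDual.ofDual K))
    (fun K L h => M.pull 1 (OrderDual.ofDual L) (OrderDual.ofDual K) (IsMor.one h))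
    (OrderDual.toDual K)

theorem RICFunctor.toCompletion_pull_one (M : RICFunctor.{u, v, w} R Υ) (L K : Υ.Level)
    (h : IsMor 1 L.1 K.1) (x : M.obj K) :
    M.toCompletion L (M.pull 1 L K h x) = M.toCompletion K x := by
  classical
  have hLK : L.1 ≤ K.1 := by simpa [IsMor] using h
  exact Module.DirectLimit.of_f (R := R) (ι := Υ.Levelᵒᵈ)
    (G := fun K => M.obj (OrderDual.ofDual K))
    (f := fun K L h => M.pull 1 (OrderDual.ofDual L) (OrderDual.ofDual K) (IsMor.one h))
    (i := OrderDual.toDual K) (j := OrderDual.toDual L) (hij := hLK)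

theorem RICFunctor.toCompletion_pull (M : RICFunctor.{u, v, w} R Υ) (g : G) (L K : Υ.Level)
    (h : IsMor g L.1 K.1) (x : M.obj K) :
    M.toCompletion L (M.pull g L K h x) =
      M.toCompletion (Υ.conj g K) (M.pull g (Υ.conj g K) K (IsMor.conj g K.1) x) := by
  have h1 : IsMor 1 L.1 (Υ.conj g K).1 := IsMor.one h.le_conj
  rw [← M.toCompletion_pull_one L (Υ.conj g K) h1, M.pull_comp]
  congr 2
  simp

open Classical in
/-- The endomorphism `x ↦ g · x` of the completion: for `x = j_K(x_K)`, the element `g · x` is the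
image of `x_K` under `[g]^* : M(K) → M(g K g⁻¹)` followed by `j_{g K g⁻¹}`. -/
noncomputable def RICFunctor.act (M : RICFunctor.{u, v, w} R Υ) (g : G) :
    M.Completion →ₗ[R] M.Completion :=
  Module.DirectLimit.lift R Υ.Levelᵒᵈ (fun K => M.obj (OrderDual.ofDual K))
    (fun K L h => M.pull 1 (OrderDual.ofDual L) (OrderDual.ofDual K) (IsMor.one h))
    (fun K => M.toCompletion (Υ.conj g (OrderDual.ofDual K)) ∘ₗ
      M.pull g (Υ.conj g (OrderDual.ofDual K)) (OrderDual.ofDual K) (IsMor.conj g _))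
    (fun K L h x => by
      simp only [LinearMap.comp_apply]
      rw [M.pull_comp]
      have key : ∀ (g' : G) (_ : g' = g) (L' K' : Υ.Level) (h' : IsMor g' L'.1 K'.1)
          (x : M.obj K'), M.toCompletion L' (M.pull g' L' K' h' x) =
            M.toCompletion (Υ.conj g K') (M.pull g (Υ.conj g K') K' (IsMor.conj g K'.1) x) := by
        rintro _ rfl L' K' h' x
        exact M.toCompletion_pull _ L' K' h' x
      exact key (g * 1) (mul_one g) _ _ _ x)

theorem RICFunctor.act_toCompletion (M : RICFunctor.{u, v, w} R Υ) (g : G) (K : Υ.Level)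
    (x : M.obj K) : M.act g (M.toCompletion K x) =
      M.toCompletion (Υ.conj g K) (M.pull g (Υ.conj g K) K (IsMor.conj g K.1) x) := by
  classical
  exact Module.DirectLimit.lift_of _ _ _

theorem RICFunctor.completion_hom_ext (M : RICFunctor.{u, v, w} R Υ)
    {f f' : M.Completion →ₗ[R] M.Completion}
    (h : ∀ K x, f (M.toCompletion K x) = f' (M.toCompletion K x)) : f = f' := by
  classical
  exact Module.DirectLimit.hom_ext fun K => LinearMap.ext (h (OrderDual.ofDual K))

/-- The completion of `M` as a representation of `G`. -/
noncomputable def RICFunctor.completionRep (M : RICFunctor.{u, v, w} R Υ) :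
    Representation R G M.Completion where
  toFun := M.act
  map_one' := M.completion_hom_ext fun K x => by
    rw [M.act_toCompletion, ← M.toCompletion_pull 1 K K (IsMor.one le_rfl), M.pull_one]
    rfl
  map_mul' g h := M.completion_hom_ext fun K x => by
    rw [Module.End.mul_apply, M.act_toCompletion, M.act_toCompletion, M.act_toCompletion,
      M.pull_comp]
    exact (M.toCompletion_pull (g * h) _ K _ x).symm

end RIC

/-! ### Spaces of compactly supported functions -/

/-- `C_R(K' \ G / K)`: the `R`-valued compactly supported functions on `G` that are invariant under
left translations by `K'` and right translations by `K`.  When `K` and `K'` are compact open, these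
are the `R`-linear combinations of characteristic functions of double cosets `K' σ K`. -/
def heckeSpace (R : Type*) [CommRing R] {G : Type*} [Group G] [TopologicalSpace G]
    (K' K : Subgroup G) : Submodule R (G → R) where
  carrier := {f | HasCompactSupport f ∧ ∀ k' ∈ K', ∀ k ∈ K, ∀ g, f (k' * g * k) = f g}
  add_mem' := by
    rintro f f' ⟨h1, h2⟩ ⟨h1', h2'⟩
    refine ⟨h1.add h1', fun k' hk' k hk g => ?_⟩
    simp [h2 k' hk' k hk g, h2' k' hk' k hk g]
  zero_mem' := ⟨HasCompactSupport.zero, fun _ _ _ _ _ => rfl⟩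
  smul_mem' := by
    rintro c f ⟨h1, h2⟩
    refine ⟨h1.comp_left (g := fun x => c * x) (mul_zero c), fun k' hk' k hk g => ?_⟩
    simp [h2 k' hk' k hk g]

/-- The transposition `f ↦ f^t = (g ↦ f(g⁻¹))`. -/
def transpose {R : Type*} [CommRing R] {G : Type*} [Group G] [TopologicalSpace G]
    [IsTopologicalGroup G] {K' K : Subgroup G} (f : heckeSpace R K' K) : heckeSpace R K K' :=
  ⟨fun g => f.1 g⁻¹, f.2.1.comp_homeomorph (Homeomorph.inv G), fun k' hk' k hk g => by
    have := f.2.2 k⁻¹ (inv_mem hk) k'⁻¹ (inv_mem hk') g⁻¹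
    simpa [mul_assoc] using this⟩

/-- The degree of an element of `C_R(K' \ G / K)`: the linear extension of
`deg ch(K' σ K) = |K' σ K / K|`, i.e. the sum over the double cosets `D = K' σ K` of the value of
`f` on `D` times the number of left cosets of `K` contained in `D`. -/
noncomputable def degree {R : Type*} [CommRing R] {G : Type*} [Group G] [TopologicalSpace G]
    {K' K : Subgroup G} (f : heckeSpace R K' K) : R :=
  ∑ᶠ D : DoubleCoset.Quotient (K' : Set G) (K : Set G),
    f.1 (Quotient.out D) *
      (Set.ncard ((QuotientGroup.mk : G → G ⧸ K) ''
        DoubleCoset.doubleCoset (Quotient.out D) (K' : Set G) (K : Set G)) : R)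

/-- `C(G/K, τ)`: the compactly supported functions `G → τ` that are invariant under right
translations by `K`. -/
def cosetFunctions (Φ : Type*) [CommRing Φ] {G : Type*} [Group G] [TopologicalSpace G]
    (K : Subgroup G) (τ : Type*) [AddCommGroup τ] [Module Φ τ] : Submodule Φ (G → τ) where
  carrier := {ξ | HasCompactSupport ξ ∧ ∀ k ∈ K, ∀ g, ξ (g * k) = ξ g}
  add_mem' := by
    rintro f f' ⟨h1, h2⟩ ⟨h1', h2'⟩
    refine ⟨h1.add h1', fun k hk g => ?_⟩
    simp [h2 k hk g, h2' k hk g]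
  zero_mem' := ⟨HasCompactSupport.zero, fun _ _ _ => rfl⟩
  smul_mem' := by
    rintro c f ⟨h1, h2⟩
    refine ⟨h1.comp_left (g := fun x => c • x) (smul_zero c), fun k hk g => ?_⟩
    simp [h2 k hk g]

/-- The action of `H` on `C(G/K, τ)`, for `ι : H → G` and `τ` a representation of `H`:
`(h ξ)(g) = h · ξ(ι(h)⁻¹ g)`. -/
def cosetFunctionsRep {Φ : Type*} [CommRing Φ] {G H : Type*} [Group G] [TopologicalSpace G]
    [IsTopologicalGroup G] [Group H] (ι : H →* G) (K : Subgroup G) {τ : Type*} [AddCommGroup τ]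
    [Module Φ τ] (ρ : Representation Φ H τ) :
    Representation Φ H (cosetFunctions Φ K τ) where
  toFun h :=
    { toFun := fun ξ => ⟨fun g => ρ h (ξ.1 ((ι h)⁻¹ * g)),
        (ξ.2.1.comp_homeomorph (Homeomorph.mulLeft (ι h)⁻¹)).comp_left (g := ρ h) (map_zero _),
        fun k hk g => by
          beta_reduce
          rw [← mul_assoc, ξ.2.2 k hk]⟩
      map_add' := fun ξ ξ' => by ext g; simp
      map_smul' := fun c ξ => by ext g; simp }
  map_one' := by ext ξ g; simp
  map_mul' h h' := by ext ξ g; simp [mul_assoc]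

/-- The element `x ⊗ f : g ↦ f(g) x` of `C(G/K, τ)`, for `f ∈ C_R(K \ G / K)` and `x ∈ τ`. -/
def tensorElement {R Φ : Type*} [CommRing R] [CommRing Φ] [Algebra R Φ] {G : Type*} [Group G]
    [TopologicalSpace G] {K : Subgroup G} {τ : Type*} [AddCommGroup τ] [Module Φ τ] (x : τ)
    (f : heckeSpace R K K) : cosetFunctions Φ K τ :=
  ⟨fun g => algebraMap R Φ (f.1 g) • x,
    f.2.1.comp_left (g := fun r => algebraMap R Φ r • x) (by simp),
    fun k hk g => by
      have := f.2.2 1 (one_mem K) k hk g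
      rw [one_mul] at this
      beta_reduce
      rw [this]⟩

/-! ### Zeta elements -/

/-- The generalized index `[V₁ : V₂] = μ(V₁) / μ(V₂)` (`μ` a Haar measure) of two compact open
subgroups: it equals `[V₁ : V₁ ∩ V₂] / [V₂ : V₁ ∩ V₂]`. -/
noncomputable def genIndex {H : Type*} [Group H] (V₁ V₂ : Subgroup H) : ℚ :=
  (V₂.relIndex V₁ : ℚ) / (V₁.relIndex V₂ : ℚ)

section Zeta

variable {G H : Type*} [Group G] [TopologicalSpace G] [Group H] [TopologicalSpace H]
  {O : Type*} [CommRing O] {ΥH : LevelFamily H}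

/-- The natural map `j_V : M(V) → colim (M ⊗ Φ)`. -/
noncomputable def toCompletionOver (M : RICFunctor O ΥH) (Φ : Type*) [Field Φ] [Algebra O Φ]
    (V : ΥH.Level) (x : M.obj V) : (M.baseChange Φ).Completion :=
  (M.baseChange Φ).toCompletion V ((1 : Φ) ⊗ₜ[O] x)

/-- `ξ ∈ C(G/K, colim (M ⊗ Φ))` is `O`-integral at level `L` (relative to the bottom level `U`):
for each `g`, the value `ξ(g)` is a finite sum `∑ [U : Vᵢ] j_{Vᵢ}(xᵢ)` with levels
`Vᵢ ⊆ H ∩ g L g⁻¹` and `xᵢ ∈ M(Vᵢ)`. -/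
def IsIntegralAt (ι : H →* G) (M : RICFunctor O ΥH) (Φ : Type*) [Field Φ] [Algebra O Φ]
    (U : ΥH.Level) {K : Subgroup G} (L : Subgroup G)
    (ξ : cosetFunctions Φ K (M.baseChange Φ).Completion) : Prop :=
  ∀ g : G, ∃ (n : ℕ) (V : Fin n → ΥH.Level) (x : ∀ i, M.obj (V i)),
    (∀ i, (V i).1 ≤ (MulAut.conj g • L).comap ι) ∧
    ξ.1 g = ∑ i, (genIndex U.1 (V i).1 : Φ) • toCompletionOver M Φ (V i) (x i)

/-- `ζ` is a zeta element for `(x_U, P, L)` with coefficients in `Φ`: it is `O`-integral at level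
`L` and has the same class as `j_U(x_U) ⊗ P` in the `H`-coinvariants of
`C(G/K, colim (M ⊗ Φ))`. -/
def IsZetaElement [IsTopologicalGroup G] (ι : H →* G) (M : RICFunctor O ΥH) (Φ : Type*) [Field Φ]
    [Algebra O Φ] (U : ΥH.Level) {K : Subgroup G} (xU : M.obj U) (P : heckeSpace O K K)
    (L : Subgroup G) (ζ : cosetFunctions Φ K (M.baseChange Φ).Completion) : Prop :=
  IsIntegralAt ι M Φ U L ζ ∧
    Representation.Coinvariants.mk
        (cosetFunctionsRep ι K (M.baseChange Φ).completionRep) ζ =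
      Representation.Coinvariants.mk
        (cosetFunctionsRep ι K (M.baseChange Φ).completionRep)
        (tensorElement (toCompletionOver M Φ U xU) P)

/-- The `(H, g)`-restriction `h ↦ P(ι(h) g)` of `P ∈ C_O(K \ G / K)`, an element of
`C_O(U \ H / H_g)` where `U = H ∩ K` and `H_g = H ∩ g K g⁻¹`. -/
def twistedRestriction [IsTopologicalGroup G] (ι : H →* G)
    (hι : Topology.IsClosedEmbedding ι) {K : Subgroup G} (P : heckeSpace O K K) (g : G) :
    heckeSpace O (K.comap ι) ((MulAut.conj g • K).comap ι) :=
  ⟨fun h => P.1 (ι h * g),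
    (P.2.1.comp_homeomorph (Homeomorph.mulRight g)).comp_isClosedEmbedding hι,
    fun k' hk' k hk h => by
      have hk2 : g⁻¹ * ι k * g ∈ K := by
        have h3 := Subgroup.mem_pointwise_smul_iff_inv_smul_mem.1 (Subgroup.mem_comap.1 hk)
        simpa [← map_inv] using h3
      have h4 := P.2.2 (ι k') (Subgroup.mem_comap.1 hk') _ hk2 (ι h * g)
      beta_reduce
      rw [← h4]
      simp [mul_assoc]⟩

/-- The set `H \ H·supp(P) / K` of double cosets `H g K` that meet the support of `P`. -/
def supportDoubleCosets (ι : H →* G) {K : Subgroup G} (P : heckeSpace O K K) :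
    Set (DoubleCoset.Quotient (ι.range : Set G) (K : Set G)) :=
  DoubleCoset.mk ι.range K '' Function.support P.1

end Zeta

end ZetaElement

/-! For the trivial functor all pullbacks are the identity, so evaluation identifies the completion
over `Φ` with `Φ`, on which `H` acts trivially (`trivialEval_injective`,
`completionRep_trivialFunctor_apply`). The coinvariants of `C(G/K, Φ)` are then controlled by sums
over double cosets `D = HgK`. These sums are invariants of a class
(`orbitSum_eq_of_coinvariants_eq`), and conversely each class has a representative living on one
coset per double coset, with the sum as its value (`exists_coinvariants_eq_orbitSum`).

Write `H_g = H ∩ gKg⁻¹` and `V_g = H ∩ gLg⁻¹`. Integrality at level `L` says that `ζ(g)` lies in `[U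
: V_g] O`, and this submodule depends only on `HgK`, by unimodularity and normality of `L` in `K`.
Hence a zeta element exists iff every sum of `P ⊗ x_U` over a double coset lies in the corresponding
`[U : V_g] O`.

That sum runs over `H/H_g`. Comparing Haar volumes of level sets turns it into `[U : H_g]` times a
sum over `H/U`, which is `deg(𝔥_g^t) x_U`. Since `[U : V_g] = [U : H_g] d_g`, cancelling the nonzero
index and the unit `x_U` leaves divisibility of the degree by `d_g`. -/

namespace ZetaElement

open MeasureTheory Measure

/-! ### Counting cosets of open subgroups. -/

section Cosets

variable {H : Type*} [Group H]

theorem ncard_image_mk (V W : Subgroup H) :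
    ((QuotientGroup.mk : H → H ⧸ W) '' (V : Set H)).ncard = W.relIndex V := by
  let f : V ⧸ W.subgroupOf V → H ⧸ W := Quotient.map' (fun v : V => (v : H)) fun a b h => by
    rw [QuotientGroup.leftRel_apply] at h ⊢
    exact h
  have hf : Function.Injective f := by
    rintro ⟨a⟩ ⟨b⟩ h
    exact QuotientGroup.eq.2 (QuotientGroup.eq.1 h : (a : H)⁻¹ * b ∈ W)
  have hr : (QuotientGroup.mk : H → H ⧸ W) '' (V : Set H) = f '' Set.univ := by
    ext y
    constructor
    · rintro ⟨v, hv, rfl⟩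
      exact ⟨QuotientGroup.mk ⟨v, hv⟩, trivial, rfl⟩
    · rintro ⟨⟨v⟩, -, rfl⟩
      exact ⟨v, v.2, rfl⟩
  rw [hr, Set.ncard_image_of_injective _ hf, Set.ncard_univ]
  rfl

/-- A function invariant under right translations by `V` takes the same value on the chosen
representative of a coset. -/
theorem apply_out_mk {A : Type*} {V : Subgroup H} {f : H → A}
    (hf : ∀ k ∈ V, ∀ g, f (g * k) = f g) (h : H) :
    f (QuotientGroup.mk h : H ⧸ V).out = f h := by
  obtain ⟨k, hk⟩ := QuotientGroup.mk_out_eq_mul V h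
  rw [hk, hf _ k.2]

variable [TopologicalSpace H] [IsTopologicalGroup H]

theorem finite_image_mk {V : Subgroup H} (hV : IsOpen (V : Set H)) {S : Set H}
    (hS : IsCompact S) : ((QuotientGroup.mk : H → H ⧸ V) '' S).Finite := by
  have := QuotientGroup.discreteTopology hV
  exact (hS.image QuotientGroup.continuous_mk).finite_of_discrete

/-- A compactly supported right `V`-invariant function is supported on finitely many cosets. -/
theorem finite_support_out {A : Type*} [Zero A] {V : Subgroup H} (hV : IsOpen (V : Set H))
    {f : H → A} (hf : HasCompactSupport f) :
    (Function.support fun y : H ⧸ V => f y.out).Finite := by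
  refine (finite_image_mk hV hf).subset fun y hy => ⟨y.out, subset_tsupport f hy, ?_⟩
  simp

end Cosets

/-! ### Haar volumes and coset counts. -/

section Volume

variable {H : Type*} [Group H] [TopologicalSpace H] [IsTopologicalGroup H]

/-- The modular character at `g` is the ratio between the right translate of Haar measure by `g` and
Haar measure itself; both are regular and left invariant, so ratio one forces equality. -/
theorem IsUnimodular.isMulRightInvariant [LocallyCompactSpace H] [MeasurableSpace H]
    [BorelSpace H] (hH : IsUnimodular H) : IsMulRightInvariant (haar : Measure H) := by
  refine ⟨fun g => ?_⟩
  have h1 := modularCharacterFun_eq_haarScalarFactor (haar : Measure H) g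
  rw [hH g] at h1
  have : Regular (map (· * g) (haar : Measure H)) := Regular.map (Homeomorph.mulRight g)
  have h2 := isMulLeftInvariant_eq_smul_of_regular (map (· * g) (haar : Measure H)) haar
  rw [← h1, one_smul] at h2
  exact h2

variable [MeasurableSpace H] [BorelSpace H] (μ : Measure H)

theorem measure_eq_ncard_mul [IsMulLeftInvariant μ] {V : Subgroup H}
    (hV : IsOpen (V : Set H)) {A : Set H}
    (hA : IsCompact A) (hAV : ∀ k ∈ V, ∀ g, g * k ∈ A ↔ g ∈ A) :
    μ A = ((QuotientGroup.mk : H → H ⧸ V) '' A).ncard * μ V := by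
  set T := (QuotientGroup.mk : H → H ⧸ V) '' A with hT
  have hfin : T.Finite := finite_image_mk hV hA
  have hU : A = ⋃ y ∈ hfin.toFinset, (fun h => y.out * h) '' (V : Set H) := by
    ext a
    simp only [Set.mem_iUnion, Set.Finite.mem_toFinset, Set.mem_image, SetLike.mem_coe,
      exists_prop]
    constructor
    · intro ha
      obtain ⟨k, hk⟩ := QuotientGroup.mk_out_eq_mul V a
      exact ⟨(a : H ⧸ V), ⟨a, ha, rfl⟩, k⁻¹, inv_mem k.2, by rw [hk]; simp⟩
    · rintro ⟨y, ⟨b, hb, rfl⟩, k, hk, rfl⟩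
      obtain ⟨k', hk'⟩ := QuotientGroup.mk_out_eq_mul V b
      rw [hAV k hk, hk', hAV _ k'.2]
      exact hb
  conv_lhs => rw [hU]
  rw [measure_biUnion_finset]
  · have : ∀ y ∈ hfin.toFinset, μ ((fun h => y.out * h) '' (V : Set H)) = μ V := fun y _ => by
      rw [Set.image_mul_left, measure_preimage_mul]
    rw [Finset.sum_congr rfl this, Finset.sum_const, Set.ncard_eq_toFinset_card _ hfin,
      nsmul_eq_mul]
  · intro y _ z _ hyz
    refine Set.disjoint_left.2 ?_
    rintro _ ⟨k, hk, rfl⟩ ⟨k', hk', h⟩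
    apply hyz
    have h' := congrArg (QuotientGroup.mk : H → H ⧸ V) h
    simp only at h'
    rw [QuotientGroup.mk_mul_of_mem _ hk, QuotientGroup.mk_mul_of_mem _ hk'] at h'
    simpa using h'.symm
  · intro y _
    rw [Set.image_mul_left]
    exact (hV.preimage (continuous_const_mul _)).measurableSet

/-- Here `A` is cut into right cosets `V y⁻¹`. Inversion makes them left cosets in `A⁻¹`, so that
only quotients of the form `H ⧸ V` occur. -/
theorem measure_eq_ncard_inv_mul [IsMulRightInvariant μ] {V : Subgroup H}
    (hV : IsOpen (V : Set H)) {A : Set H}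
    (hA : IsCompact A) (hVA : ∀ k ∈ V, ∀ g, k * g ∈ A ↔ g ∈ A) :
    μ A = ((QuotientGroup.mk : H → H ⧸ V) '' A⁻¹).ncard * μ V := by
  set T := (QuotientGroup.mk : H → H ⧸ V) '' A⁻¹ with hT
  have hfin : T.Finite := finite_image_mk hV hA.inv
  have hU : A = ⋃ y ∈ hfin.toFinset, (fun h => h * y.out⁻¹) '' (V : Set H) := by
    ext a
    simp only [Set.mem_iUnion, Set.Finite.mem_toFinset, Set.mem_image, SetLike.mem_coe,
      exists_prop]
    constructor
    · intro ha
      obtain ⟨k, hk⟩ := QuotientGroup.mk_out_eq_mul V a⁻¹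
      exact ⟨(a⁻¹ : H), ⟨a⁻¹, by simpa using ha, rfl⟩, k, k.2, by rw [hk]; simp⟩
    · rintro ⟨y, ⟨b, hb, rfl⟩, k, hk, rfl⟩
      obtain ⟨k', hk'⟩ := QuotientGroup.mk_out_eq_mul V b
      rw [hVA k hk, hk', mul_inv_rev, hVA _ (inv_mem k'.2)]
      exact hb
  conv_lhs => rw [hU]
  rw [measure_biUnion_finset]
  · have : ∀ y ∈ hfin.toFinset, μ ((fun h => h * y.out⁻¹) '' (V : Set H)) = μ V := fun y _ => by
      rw [Set.image_mul_right, measure_preimage_mul_right]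
    rw [Finset.sum_congr rfl this, Finset.sum_const, Set.ncard_eq_toFinset_card _ hfin,
      nsmul_eq_mul]
  · intro y _ z _ hyz
    refine Set.disjoint_left.2 ?_
    rintro _ ⟨k, hk, rfl⟩ ⟨k', hk', h⟩
    apply hyz
    have h' := congrArg (fun x : H => (QuotientGroup.mk x⁻¹ : H ⧸ V)) h
    simp only [mul_inv_rev, inv_inv] at h'
    rw [QuotientGroup.mk_mul_of_mem _ (inv_mem hk),
      QuotientGroup.mk_mul_of_mem _ (inv_mem hk')] at h'
    simpa using h'.symm
  · intro y _
    rw [Set.image_mul_right]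
    exact (hV.preimage (continuous_mul_const _)).measurableSet

theorem measure_eq_relIndex_mul [IsMulLeftInvariant μ] {V W : Subgroup H}
    (hV : IsOpen (V : Set H)) (hW : IsOpen (W : Set H)) (hVc : IsCompact (V : Set H)) :
    μ V = W.relIndex V * μ ((V ⊓ W : Subgroup H) : Set H) := by
  rw [measure_eq_ncard_mul μ (V := V ⊓ W) (hV.inter hW) hVc
    (fun k hk g => V.mul_mem_cancel_right hk.1), ncard_image_mk, Subgroup.inf_relIndex_left]

variable [IsHaarMeasure μ]

omit [IsTopologicalGroup H] [BorelSpace H] in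
theorem measure_toReal_pos {V : Subgroup H} (hV : IsOpen (V : Set H))
    (hVc : IsCompact (V : Set H)) : 0 < (μ V).toReal :=
  ENNReal.toReal_pos (hV.measure_ne_zero μ ⟨1, one_mem V⟩) hVc.measure_ne_top

/-- The generalized index of two compact open subgroups is the quotient of their volumes. -/
theorem genIndex_eq_measure_div {V W : Subgroup H} (hV : IsOpen (V : Set H))
    (hVc : IsCompact (V : Set H)) (hW : IsOpen (W : Set H)) (hWc : IsCompact (W : Set H)) :
    (genIndex V W : ℝ) = (μ V).toReal / (μ W).toReal := by
  have h1 := congrArg ENNReal.toReal (measure_eq_relIndex_mul μ hV hW hVc)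
  have h2 := congrArg ENNReal.toReal (measure_eq_relIndex_mul μ hW hV hWc)
  have hp := measure_toReal_pos μ (V := V ⊓ W) (hV.inter hW)
    (hVc.inter_right (Subgroup.isClosed_of_isOpen W hW))
  rw [inf_comm W V] at h2
  rw [ENNReal.toReal_mul, ENNReal.toReal_natCast] at h1 h2
  rw [h1, h2, genIndex, mul_div_mul_right _ _ hp.ne']
  push_cast
  rfl

end Volume

/-! ### Generalized indices. -/

section Index

variable {H : Type*} [Group H] [TopologicalSpace H] [IsTopologicalGroup H]
  [LocallyCompactSpace H] {U V W : Subgroup H}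

theorem genIndex_ne_zero (hU : IsOpen (U : Set H)) (hUc : IsCompact (U : Set H))
    (hV : IsOpen (V : Set H)) (hVc : IsCompact (V : Set H)) : genIndex U V ≠ 0 := by
  borelize H
  have h := genIndex_eq_measure_div (haar : Measure H) hU hUc hV hVc
  have h1 := measure_toReal_pos (haar : Measure H) hU hUc
  have h2 := measure_toReal_pos (haar : Measure H) hV hVc
  intro h0
  rw [h0, Rat.cast_zero] at h
  exact (div_pos h1 h2).ne h

theorem genIndex_mul_relIndex (hU : IsOpen (U : Set H)) (hUc : IsCompact (U : Set H))
    (hV : IsOpen (V : Set H)) (hVc : IsCompact (V : Set H))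
    (hW : IsOpen (W : Set H)) (hWc : IsCompact (W : Set H)) (hWV : W ≤ V) :
    genIndex U W = genIndex U V * W.relIndex V := by
  borelize H
  have h2 := measure_toReal_pos (haar : Measure H) hV hVc
  have h3 := measure_toReal_pos (haar : Measure H) hW hWc
  have h4 := congrArg ENNReal.toReal (measure_eq_relIndex_mul (haar : Measure H) hV hW hVc)
  rw [inf_eq_right.2 hWV, ENNReal.toReal_mul, ENNReal.toReal_natCast] at h4
  rw [← Rat.cast_inj (α := ℝ)]
  push_cast
  rw [genIndex_eq_measure_div haar hU hUc hW hWc, genIndex_eq_measure_div haar hU hUc hV hVc]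
  field_simp
  rw [h4]
  ring

theorem genIndex_conj (hH : IsUnimodular H) (hU : IsOpen (U : Set H))
    (hUc : IsCompact (U : Set H)) (hV : IsOpen (V : Set H)) (hVc : IsCompact (V : Set H))
    (h : H) (hW : IsOpen (W : Set H)) (hWc : IsCompact (W : Set H))
    (hWV : ∀ x, x ∈ W ↔ h⁻¹ * x * h ∈ V) :
    genIndex U W = genIndex U V := by
  borelize H
  have := hH.isMulRightInvariant
  rw [← Rat.cast_inj (α := ℝ), genIndex_eq_measure_div haar hU hUc hW hWc,
    genIndex_eq_measure_div haar hU hUc hV hVc]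
  congr 2
  have : (W : Set H) = (fun x => h⁻¹ * x) ⁻¹' ((fun x => x * h) ⁻¹' (V : Set H)) := by
    ext x
    exact hWV x
  rw [this, measure_preimage_mul, measure_preimage_mul_right]

/-- For a compact set `A` invariant under `U` on the left and `V` on the right,
`|A / V| = [U : V] |U \ A|`. -/
theorem ncard_image_mk_eq (hH : IsUnimodular H) (hU : IsOpen (U : Set H))
    (hUc : IsCompact (U : Set H)) (hV : IsOpen (V : Set H)) (hVc : IsCompact (V : Set H))
    {A : Set H} (hA : IsCompact A) (hUA : ∀ k ∈ U, ∀ g, k * g ∈ A ↔ g ∈ A)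
    (hAV : ∀ k ∈ V, ∀ g, g * k ∈ A ↔ g ∈ A) :
    (((QuotientGroup.mk : H → H ⧸ V) '' A).ncard : ℚ) =
      genIndex U V * ((QuotientGroup.mk : H → H ⧸ U) '' A⁻¹).ncard := by
  borelize H
  have := hH.isMulRightInvariant
  -- The volume of `A` is computed twice, by left cosets of `V` and by right cosets of `U`.
  have h1 := congrArg ENNReal.toReal (measure_eq_ncard_mul (haar : Measure H) hV hA hAV)
  have h2 := congrArg ENNReal.toReal (measure_eq_ncard_inv_mul (haar : Measure H) hU hA hUA)
  have h3 := measure_toReal_pos (haar : Measure H) hV hVc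
  rw [ENNReal.toReal_mul, ENNReal.toReal_natCast] at h1 h2
  rw [← Rat.cast_inj (α := ℝ)]
  push_cast
  rw [genIndex_eq_measure_div haar hU hUc hV hVc]
  field_simp
  rw [← h1, h2, mul_comm]

end Index
end ZetaElement

namespace ZetaElement

/-! ### Sums over cosets, degrees and inversion. -/

section CosetSums

variable {H : Type*} [Group H] [TopologicalSpace H] [IsTopologicalGroup H]

/-- The degree of `f` is the sum of its values over the left cosets of `K`. -/
theorem degree_eq_finsum {R : Type*} [CommRing R] {K' K : Subgroup H}
    (hK : IsOpen (K : Set H)) (f : heckeSpace R K' K) :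
    degree f = ∑ᶠ y : H ⧸ K, f.1 y.out := by
  classical
  have hr : ∀ k ∈ K, ∀ g, f.1 (g * k) = f.1 g := fun k hk g => by
    simpa using f.2.2 1 (one_mem _) k hk g
  have hl : ∀ k ∈ K', ∀ g, f.1 (k * g) = f.1 g := fun k hk g => by
    simpa using f.2.2 k hk 1 (one_mem _) g
  have hfin := finite_support_out hK f.2.1
  -- The sum over cosets is regrouped along the fibres of `π`, on which `f` is constant; the size of
  -- a fibre is the count appearing in `degree`.
  let π : H ⧸ K → DoubleCoset.Quotient (K' : Set H) (K : Set H) :=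
    fun y => DoubleCoset.mk K' K y.out
  have hπ : ∀ g : H, π (QuotientGroup.mk g) = DoubleCoset.mk K' K g := fun g => by
    obtain ⟨k, hk⟩ := QuotientGroup.mk_out_eq_mul K g
    exact (DoubleCoset.eq K' K _ _).2 ⟨1, one_mem _, k⁻¹, inv_mem k.2, by rw [hk]; simp⟩
  have hout : ∀ y : H ⧸ K, f.1 (Quotient.out (π y)) = f.1 y.out := fun y => by
    obtain ⟨h, k, hh, hk, e⟩ := DoubleCoset.mk_out_eq_mul K' K y.out
    change f.1 (Quotient.out (DoubleCoset.mk K' K y.out)) = _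
    rw [e, hr k hk, hl h hh]
  rw [finsum_eq_sum _ hfin, ← Finset.sum_fiberwise_of_maps_to
    (fun y hy => Finset.mem_image_of_mem π hy), degree,
    finsum_eq_finsetSum_of_support_subset (s := hfin.toFinset.image π)]
  · refine Finset.sum_congr rfl fun D hD => ?_
    obtain ⟨y₀, hy₀, rfl⟩ := Finset.mem_image.1 hD
    have hcon : ∀ y ∈ hfin.toFinset.filter (fun y => π y = π y₀),
        f.1 y.out = f.1 (Quotient.out (π y₀)) := fun y hy => by
      rw [← hout y, (Finset.mem_filter.1 hy).2]
    rw [Finset.sum_congr rfl hcon, Finset.sum_const, nsmul_eq_mul, mul_comm]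
    congr 2
    rw [← Set.ncard_coe_finset]
    congr 1
    ext y
    simp only [Set.mem_image, Finset.coe_filter, Set.Finite.mem_toFinset, Set.mem_ofPred_eq,
      Function.mem_support]
    constructor
    · rintro ⟨a, ha, rfl⟩
      have h1 : π (QuotientGroup.mk a) = π y₀ := by
        rw [hπ, ← DoubleCoset.out_eq' K' K (π y₀)]
        obtain ⟨h, hh, k, hk, e⟩ := DoubleCoset.mem_doubleCoset.1 ha
        exact ((DoubleCoset.eq K' K _ _).2 ⟨h, hh, k, hk, e⟩).symm
      refine ⟨?_, h1⟩
      rw [← hout, h1, hout]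
      simpa using hy₀
    · rintro ⟨-, h2⟩
      refine ⟨y.out, ?_, by simp⟩
      rw [← h2]
      obtain ⟨h, k, hh, hk, e⟩ := DoubleCoset.mk_out_eq_mul K' K y.out
      refine DoubleCoset.mem_doubleCoset.2 ⟨h⁻¹, inv_mem hh, k⁻¹, inv_mem hk, ?_⟩
      change _ = h⁻¹ * Quotient.out (DoubleCoset.mk K' K y.out) * k⁻¹
      rw [e]; group
  · intro D hD
    have h1 : f.1 (Quotient.out D) ≠ 0 := fun h => hD (by simp [h])
    refine Finset.mem_coe.2 (Finset.mem_image.2 ⟨QuotientGroup.mk (Quotient.out D), ?_, ?_⟩)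
    · simpa [apply_out_mk hr] using h1
    · rw [hπ, DoubleCoset.out_eq']

/-- Grouping by value reduces identities between sums to counting level sets. The fibre over `0` may
be infinite, but its junk cardinality is multiplied by `0`. -/
theorem finsum_eq_finsum_ncard {α A : Type*} [Semiring A] (F : α → A)
    (hF : (Function.support F).Finite) :
    ∑ᶠ y, F y = ∑ᶠ c : A, ({y | F y = c}.ncard : A) * c := by
  classical
  rw [finsum_eq_sum _ hF, ← Finset.sum_fiberwise_of_maps_to
    (fun y hy => Finset.mem_image_of_mem F hy),
    finsum_eq_finsetSum_of_support_subset (s := hF.toFinset.image F)]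
  · refine Finset.sum_congr rfl fun c hc => ?_
    obtain ⟨y₀, hy₀, rfl⟩ := Finset.mem_image.1 hc
    rw [Finset.sum_congr rfl (fun y hy => (Finset.mem_filter.1 hy).2), Finset.sum_const,
      nsmul_eq_mul, ← Set.ncard_coe_finset]
    congr 3
    ext y
    simp only [Set.mem_ofPred_eq, Finset.coe_filter, Set.Finite.mem_toFinset,
      Function.mem_support, and_iff_right_iff_imp]
    intro h
    rw [h]
    simpa using hy₀
  · intro c hc
    have hc0 : c ≠ 0 := fun h => hc (by simp [h])
    have : {y | F y = c}.Nonempty := by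
      by_contra h
      rw [Set.not_nonempty_iff_eq_empty] at h
      exact hc (by simp [h])
    obtain ⟨y, rfl⟩ := this
    exact Finset.mem_coe.2 (Finset.mem_image.2 ⟨y, by simpa using hc0, rfl⟩)

theorem isOpen_of_forall_mul_mem {V : Subgroup H} (hV : IsOpen (V : Set H)) {S : Set H}
    (hS : ∀ k ∈ V, ∀ g ∈ S, g * k ∈ S) : IsOpen S := by
  refine isOpen_iff_mem_nhds.2 fun g hg => ?_
  have h1 : IsOpen ((fun x => g⁻¹ * x) ⁻¹' (V : Set H)) := hV.preimage (continuous_const_mul _)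
  refine Filter.mem_of_superset (h1.mem_nhds (by simp)) fun x hx => ?_
  simpa using hS _ hx g hg

/-- The complement of a level set is a union of cosets of `V`, hence open; for `c ≠ 0` the level set
is thus closed inside the compact support. -/
theorem isCompact_preimage_singleton {A : Type*} [Zero A] {V : Subgroup H}
    (hV : IsOpen (V : Set H)) {f : H → A} (hf : HasCompactSupport f)
    (hr : ∀ k ∈ V, ∀ g, f (g * k) = f g) {c : A} (hc : c ≠ 0) : IsCompact (f ⁻¹' {c}) := by
  refine hf.isCompact.of_isClosed_subset ?_ ?_
  · rw [← isOpen_compl_iff]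
    refine isOpen_of_forall_mul_mem hV fun k hk g hg => ?_
    simpa [hr k hk] using hg
  · intro x hx
    refine subset_tsupport f ?_
    rw [Function.mem_support, show f x = c from hx]
    exact hc

/-- This is where unimodularity produces the transpose. Each level set of a nonzero value is compact
and bi-invariant, so `ncard_image_mk_eq` compares its two coset counts with the same factor `[U :
V]`. -/
theorem finsum_eq_genIndex_mul_finsum_inv [LocallyCompactSpace H] (hH : IsUnimodular H)
    {U V : Subgroup H} (hU : IsOpen (U : Set H))
    (hUc : IsCompact (U : Set H)) (hV : IsOpen (V : Set H)) (hVc : IsCompact (V : Set H))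
    {Φ : Type*} [Field Φ] [CharZero Φ] {f : H → Φ} (hf : HasCompactSupport f)
    (hl : ∀ k ∈ U, ∀ g, f (k * g) = f g) (hr : ∀ k ∈ V, ∀ g, f (g * k) = f g) :
    ∑ᶠ y : H ⧸ V, f y.out = (genIndex U V : Φ) * ∑ᶠ y : H ⧸ U, f (y.out)⁻¹ := by
  have hri : ∀ k ∈ U, ∀ g, f (g * k)⁻¹ = f g⁻¹ := fun k hk g => by
    rw [mul_inv_rev, hl _ (inv_mem hk)]
  rw [finsum_eq_finsum_ncard _ (finite_support_out hV hf),
    finsum_eq_finsum_ncard (fun y : H ⧸ U => f (y.out)⁻¹)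
      (finite_support_out hU (f := fun h => f h⁻¹) (hf.comp_homeomorph (Homeomorph.inv H))),
    mul_finsum]
  refine finsum_congr fun c => ?_
  rcases eq_or_ne c 0 with rfl | hc
  · simp
  have h1 : {y : H ⧸ V | f y.out = c} = QuotientGroup.mk '' (f ⁻¹' {c}) := by
    ext y
    constructor
    · exact fun hy => ⟨y.out, hy, by simp⟩
    · rintro ⟨a, ha, rfl⟩
      exact (apply_out_mk hr a).trans ha
  have h2 : {y : H ⧸ U | f (y.out)⁻¹ = c} = QuotientGroup.mk '' (f ⁻¹' {c})⁻¹ := by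
    ext y
    constructor
    · exact fun hy => ⟨y.out, hy, by simp⟩
    · rintro ⟨a, ha, rfl⟩
      exact (apply_out_mk (f := fun h => f h⁻¹) hri a).trans ha
  have h3 := ncard_image_mk_eq hH hU hUc hV hVc (A := f ⁻¹' {c})
    (isCompact_preimage_singleton hV hf hr hc) (fun k hk g => by simp [hl k hk])
    (fun k hk g => by simp [hr k hk])
  rw [h1, h2, ← mul_assoc]
  congr 1
  exact_mod_cast congrArg (Rat.cast : ℚ → Φ) h3

end CosetSums
end ZetaElement

namespace ZetaElement

/-! ### The completion of the trivial functor is `Φ` with trivial action. -/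

section TrivialCompletion

universe u v

variable {H : Type u} [Group H] [TopologicalSpace H] {O : Type v} [CommRing O]
  (ΥH : LevelFamily H) (Φ : Type*) [Field Φ] [Algebra O Φ]

/-- The identification of a level of the trivial functor over `Φ` with `Φ`. -/
noncomputable def trivialEvalLevel (V : ΥH.Level) :
    ((trivialFunctor O ΥH).baseChange Φ).obj V ≃ₗ[Φ] Φ :=
  TensorProduct.AlgebraTensorModule.rid O Φ Φ

theorem trivialEvalLevel_tmul (V : ΥH.Level) (x : O) :
    trivialEvalLevel ΥH Φ V ((1 : Φ) ⊗ₜ[O] x) = algebraMap O Φ x :=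
  (TensorProduct.AlgebraTensorModule.rid_tmul _ x (1 : Φ)).trans
    (Algebra.algebraMap_eq_smul_one x).symm

theorem trivialEvalLevel_pull (h : H) (V W : ΥH.Level) (hm : IsMor h V.1 W.1)
    (x : ((trivialFunctor O ΥH).baseChange Φ).obj W) :
    trivialEvalLevel ΥH Φ V (((trivialFunctor O ΥH).baseChange Φ).pull h V W hm x) =
      trivialEvalLevel ΥH Φ W x :=
  congrArg (TensorProduct.AlgebraTensorModule.rid O Φ Φ)
    (LinearMap.congr_fun (LinearMap.baseChange_id (R := O) (A := Φ) (M := O)) x)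

open Classical in
/-- The identification of the completion of the trivial functor over `Φ` with `Φ`. -/
noncomputable def trivialEval :
    ((trivialFunctor O ΥH).baseChange Φ).Completion →ₗ[Φ] Φ :=
  Module.DirectLimit.lift Φ ΥH.Levelᵒᵈ
    (fun K => ((trivialFunctor O ΥH).baseChange Φ).obj (OrderDual.ofDual K))
    (fun K L h => ((trivialFunctor O ΥH).baseChange Φ).pull 1 (OrderDual.ofDual L)
      (OrderDual.ofDual K) (IsMor.one h))
    (fun K => (trivialEvalLevel ΥH Φ (OrderDual.ofDual K)).toLinearMap)
    (fun _ _ h x => trivialEvalLevel_pull ΥH Φ 1 _ _ (IsMor.one h) x)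

theorem trivialEval_toCompletion (V : ΥH.Level)
    (x : ((trivialFunctor O ΥH).baseChange Φ).obj V) :
    trivialEval ΥH Φ (((trivialFunctor O ΥH).baseChange Φ).toCompletion V x) =
      trivialEvalLevel ΥH Φ V x := by
  classical
  exact Module.DirectLimit.lift_of _ _ _

theorem trivialEval_toCompletionOver (V : ΥH.Level) (x : O) :
    trivialEval ΥH Φ (toCompletionOver (trivialFunctor O ΥH) Φ V x) = algebraMap O Φ x :=
  (trivialEval_toCompletion ΥH Φ V _).trans (trivialEvalLevel_tmul ΥH Φ V x)

theorem trivialEval_injective : Function.Injective (trivialEval (O := O) ΥH Φ) := by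
  classical
  -- Directedness comes from stability under intersection; it lets injectivity be checked level by
  -- level.
  have : IsDirectedOrder ΥH.Levelᵒᵈ := ⟨fun K L =>
    ⟨OrderDual.toDual ⟨(OrderDual.ofDual K).1 ⊓ (OrderDual.ofDual L).1,
      ΥH.inf_mem _ (OrderDual.ofDual K).2 _ (OrderDual.ofDual L).2⟩,
      (inf_le_left : (OrderDual.ofDual K).1 ⊓ (OrderDual.ofDual L).1 ≤ (OrderDual.ofDual K).1),
      (inf_le_right : (OrderDual.ofDual K).1 ⊓ (OrderDual.ofDual L).1 ≤ (OrderDual.ofDual L).1)⟩⟩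
  exact Module.DirectLimit.lift_injective _ _
    fun K => (trivialEvalLevel ΥH Φ (OrderDual.ofDual K)).injective

theorem completionRep_trivialFunctor_apply (h : H)
    (z : ((trivialFunctor O ΥH).baseChange Φ).Completion) :
    ((trivialFunctor O ΥH).baseChange Φ).completionRep h z = z := by
  have key : trivialEval ΥH Φ ∘ₗ ((trivialFunctor O ΥH).baseChange Φ).completionRep h =
      trivialEval ΥH Φ := by
    classical
    refine Module.DirectLimit.hom_ext fun K => LinearMap.ext fun x => ?_
    refine (congrArg (trivialEval ΥH Φ)
      (((trivialFunctor O ΥH).baseChange Φ).act_toCompletion h (OrderDual.ofDual K) x)).trans ?_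
    rw [trivialEval_toCompletion, trivialEvalLevel_pull]
    exact (trivialEval_toCompletion ΥH Φ _ x).symm
  exact trivialEval_injective ΥH Φ (LinearMap.congr_fun key z)

end TrivialCompletion
end ZetaElement

namespace ZetaElement

/-! ### Sums over double cosets `HgK`. -/

section OrbitSums

variable {G H : Type*} [Group G] [Group H] (ι : H →* G) (K : Subgroup G)

theorem doubleCoset_mk_out (g : G) :
    DoubleCoset.mk ι.range K (QuotientGroup.mk g : G ⧸ K).out = DoubleCoset.mk ι.range K g := by
  obtain ⟨k, hk⟩ := QuotientGroup.mk_out_eq_mul K g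
  exact (DoubleCoset.eq _ K _ _).2 ⟨1, one_mem _, k⁻¹, inv_mem k.2, by rw [hk]; simp⟩

/-- The set of cosets `x K` contained in the double coset `D ∈ H \ G / K`. -/
def cosetsIn (D : DoubleCoset.Quotient (ι.range : Set G) (K : Set G)) : Set (G ⧸ K) :=
  {x | DoubleCoset.mk ι.range K x.out = D}

/-- The sum of the values of a right `K`-invariant function over the cosets of `K` contained in
a double coset `D ∈ H \ G / K`. -/
noncomputable def orbitSum {A : Type*} [AddCommMonoid A]
    (D : DoubleCoset.Quotient (ι.range : Set G) (K : Set G)) (f : G → A) : A :=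
  ∑ᶠ x ∈ cosetsIn ι K D, f x.out

variable {ι K}

theorem mem_comap_conj_smul {L : Subgroup G} {g : G} {h : H} :
    h ∈ (MulAut.conj g • L).comap ι ↔ g⁻¹ * ι h * g ∈ L := by
  rw [Subgroup.mem_comap, Subgroup.mem_pointwise_smul_iff_inv_smul_mem, ← map_inv]
  simp

theorem mk_mem_cosetsIn {D : DoubleCoset.Quotient (ι.range : Set G) (K : Set G)} {g : G} :
    (QuotientGroup.mk g : G ⧸ K) ∈ cosetsIn ι K D ↔ DoubleCoset.mk ι.range K g = D := by
  rw [← doubleCoset_mk_out ι K g]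
  rfl

theorem doubleCoset_mk_map_mul (h : H) (g : G) :
    DoubleCoset.mk ι.range K (ι h * g) = DoubleCoset.mk ι.range K g :=
  (DoubleCoset.eq _ K _ _).2 ⟨ι h⁻¹, ⟨h⁻¹, rfl⟩, 1, one_mem _, by simp⟩

theorem smul_mem_cosetsIn {D : DoubleCoset.Quotient (ι.range : Set G) (K : Set G)} (h : H)
    (x : G ⧸ K) : ι h • x ∈ cosetsIn ι K D ↔ x ∈ cosetsIn ι K D := by
  obtain ⟨g, rfl⟩ := QuotientGroup.mk_surjective x
  rw [MulAction.Quotient.smul_mk, smul_eq_mul, mk_mem_cosetsIn, mk_mem_cosetsIn,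
    doubleCoset_mk_map_mul]

theorem orbitSum_translate {A : Type*} [AddCommMonoid A]
    (D : DoubleCoset.Quotient (ι.range : Set G) (K : Set G)) {f : G → A}
    (hf : ∀ k ∈ K, ∀ g, f (g * k) = f g) (h : H) :
    orbitSum ι K D (fun g => f ((ι h)⁻¹ * g)) = orbitSum ι K D f := by
  refine finsum_mem_eq_of_bijOn (fun x => ι h⁻¹ • x)
    ((MulAction.toPerm (ι h⁻¹)).bijOn fun x => smul_mem_cosetsIn h⁻¹ x) fun x _ => ?_
  obtain ⟨g, rfl⟩ := QuotientGroup.mk_surjective x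
  refine (apply_out_mk (f := fun g => f ((ι h)⁻¹ * g))
    (fun k hk g => by rw [← mul_assoc, hf k hk]) g).trans ?_
  simp only [MulAction.Quotient.smul_mk, smul_eq_mul]
  rw [apply_out_mk hf, map_inv]

/-- The sum over a double coset `H g K` as a sum over `H / (H ∩ g K g⁻¹)`. -/
theorem orbitSum_mk {A : Type*} [AddCommMonoid A] {f : G → A}
    (hf : ∀ k ∈ K, ∀ g, f (g * k) = f g) (g : G) :
    orbitSum ι K (DoubleCoset.mk ι.range K g) f =
      ∑ᶠ y : H ⧸ (MulAut.conj g • K).comap ι, f (ι y.out * g) := by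
  -- This is the orbit map of the point `gK`, whose stabilizer in `H` is `H ∩ gKg⁻¹`.
  let e : H ⧸ (MulAut.conj g • K).comap ι → G ⧸ K := fun y => QuotientGroup.mk (ι y.out * g)
  have he : Function.Injective e := fun y z hyz => by
    have h1 := QuotientGroup.eq.1 hyz
    rw [← Quotient.out_eq' y, ← Quotient.out_eq' z]
    refine QuotientGroup.eq.2 (mem_comap_conj_smul.2 ?_)
    simpa [mul_assoc] using h1
  have hr : Set.range e = cosetsIn ι K (DoubleCoset.mk ι.range K g) := by
    ext x
    constructor
    · rintro ⟨y, rfl⟩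
      exact mk_mem_cosetsIn.2 (doubleCoset_mk_map_mul _ _)
    · obtain ⟨a, rfl⟩ := QuotientGroup.mk_surjective x
      intro ha
      obtain ⟨_, ⟨h, rfl⟩, k, hk, rfl⟩ := (DoubleCoset.eq _ K _ _).1 (mk_mem_cosetsIn.1 ha).symm
      refine ⟨QuotientGroup.mk h, QuotientGroup.eq.2 ?_⟩
      obtain ⟨v, hv⟩ := QuotientGroup.mk_out_eq_mul ((MulAut.conj g • K).comap ι) h
      rw [hv]
      have := K.mul_mem (inv_mem (mem_comap_conj_smul.1 v.2)) hk
      simpa [mul_assoc] using this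
  rw [orbitSum, ← hr, finsum_mem_range he]
  exact finsum_congr fun y => apply_out_mk hf _

theorem orbitSum_mem {A σ : Type*} [AddCommMonoid A] [SetLike σ A] [AddSubmonoidClass σ A] (N : σ)
    {D : DoubleCoset.Quotient (ι.range : Set G) (K : Set G)} {f : G → A}
    (h : ∀ g, DoubleCoset.mk ι.range K g = D → f g ∈ N) : orbitSum ι K D f ∈ N :=
  finsum_mem_induction (· ∈ N) (zero_mem N) (fun _ _ => add_mem) fun _ hx => h _ hx

end OrbitSums

/-! ### Coinvariants when `H` acts trivially on the coefficients. -/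

section Coinvariants

variable {G H : Type*} [Group G] [TopologicalSpace G] [IsTopologicalGroup G] [Group H]
  {ι : H →* G} {K : Subgroup G} {Φ : Type*} [CommRing Φ] {τ : Type*} [AddCommGroup τ]
  [Module Φ τ]

/-- `orbitSum` as a linear functional on compactly supported functions. -/
noncomputable def orbitSumLinear (hK : IsOpen (K : Set G))
    (D : DoubleCoset.Quotient (ι.range : Set G) (K : Set G)) : cosetFunctions Φ K τ →ₗ[Φ] τ where
  toFun ξ := orbitSum ι K D ξ.1
  map_add' ξ ξ' := finsum_mem_add_distrib' ((finite_support_out hK ξ.2.1).inter_of_right _)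
    ((finite_support_out hK ξ'.2.1).inter_of_right _)
  map_smul' c ξ := ((DistribSMul.toAddMonoidHom τ c).map_finsum_mem'
    (f := fun x : G ⧸ K => ξ.1 x.out) ((finite_support_out hK ξ.2.1).inter_of_right _)).symm

variable {ρ : Representation Φ H τ}

/-- If `H` acts trivially on the coefficients, functions with the same class in the
coinvariants have the same sums over all double cosets. -/
theorem orbitSum_eq_of_coinvariants_eq (hK : IsOpen (K : Set G)) (hρ : ∀ h z, ρ h z = z)
    {ξ ξ' : cosetFunctions Φ K τ}
    (h : Representation.Coinvariants.mk (cosetFunctionsRep ι K ρ) ξ =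
      Representation.Coinvariants.mk (cosetFunctionsRep ι K ρ) ξ')
    (D : DoubleCoset.Quotient (ι.range : Set G) (K : Set G)) :
    orbitSum ι K D ξ.1 = orbitSum ι K D ξ'.1 := by
  -- Invariance under `H` lets the functional factor through the coinvariants.
  have hinv : ∀ h : H, orbitSumLinear hK D ∘ₗ cosetFunctionsRep ι K ρ h =
      orbitSumLinear (Φ := Φ) (τ := τ) hK D := fun h => by
    ext ξ
    refine Eq.trans ?_ (orbitSum_translate D ξ.2.2 h)
    exact congrArg (orbitSum ι K D) (funext fun g => hρ h (ξ.1 ((ι h)⁻¹ * g)))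
  exact congrArg (Representation.Coinvariants.lift _ (orbitSumLinear hK D) hinv) h

open Classical in
/-- The function supported on the coset `g K` with value `m`. -/
noncomputable def cosetSingle (hKc : IsCompact (K : Set G)) (g : G)
    (m : τ) : cosetFunctions Φ K τ :=
  ⟨fun a => if (QuotientGroup.mk a : G ⧸ K) = QuotientGroup.mk g then m else 0, by
    refine HasCompactSupport.intro (K := (fun x => g * x) '' (K : Set G))
      (hKc.image (continuous_const_mul g)) fun a ha => if_neg fun h => ha ?_
    exact ⟨g⁻¹ * a, QuotientGroup.eq.1 h.symm, by simp⟩, fun k hk a => by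
    beta_reduce
    rw [QuotientGroup.mk_mul_of_mem a hk]⟩

/-- With `g' = h g k`, translation by `h` carries the coset `gK` to `g'K`, and the value `m` is
unchanged because `ρ` is trivial. -/
theorem coinvariants_mk_cosetSingle (hKc : IsCompact (K : Set G))
    (hρ : ∀ h z, ρ h z = z) {g g' : G}
    (hg : DoubleCoset.mk ι.range K g = DoubleCoset.mk ι.range K g') (m : τ) :
    Representation.Coinvariants.mk (cosetFunctionsRep ι K ρ) (cosetSingle hKc g m) =
      Representation.Coinvariants.mk (cosetFunctionsRep ι K ρ) (cosetSingle hKc g' m) := by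
  classical
  obtain ⟨_, ⟨h, rfl⟩, k, hk, rfl⟩ := (DoubleCoset.eq _ K _ _).1 hg
  rw [← Representation.Coinvariants.mk_self_apply _ h (cosetSingle hKc g m)]
  congr 1
  ext a
  refine (hρ h _).trans ?_
  have : ((QuotientGroup.mk ((ι h)⁻¹ * a) : G ⧸ K) = QuotientGroup.mk g) ↔
      ((QuotientGroup.mk a : G ⧸ K) = QuotientGroup.mk (ι h * g * k)) := by
    rw [QuotientGroup.mk_mul_of_mem _ hk, QuotientGroup.eq, QuotientGroup.eq]
    simp [mul_assoc]
  exact if_congr this rfl rfl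

theorem sum_cosetSingle (hK : IsOpen (K : Set G)) (hKc : IsCompact (K : Set G))
    (ξ : cosetFunctions Φ K τ) :
    ∑ x ∈ (finite_support_out hK ξ.2.1).toFinset, cosetSingle hKc x.out (ξ.1 x.out) = ξ := by
  classical
  ext a
  rw [Submodule.coe_sum, Finset.sum_apply,
    Finset.sum_eq_single (QuotientGroup.mk a : G ⧸ K)]
  · simp only [cosetSingle]
    rw [if_pos (by simp)]
    exact apply_out_mk ξ.2.2 a
  · intro x _ hx
    exact if_neg fun h => hx (by simpa using h.symm)
  · intro hx
    rw [Set.Finite.mem_toFinset, Function.notMem_support] at hx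
    rw [hx]
    simp [cosetSingle]

/-- Every class in the coinvariants has a representative supported on one coset in each double
coset, where its value is the sum over the double coset. -/
theorem exists_coinvariants_eq_orbitSum (hK : IsOpen (K : Set G)) (hKc : IsCompact (K : Set G))
    (hρ : ∀ h z, ρ h z = z) (ξ : cosetFunctions Φ K τ) :
    ∃ ζ : cosetFunctions Φ K τ,
      Representation.Coinvariants.mk (cosetFunctionsRep ι K ρ) ζ =
        Representation.Coinvariants.mk (cosetFunctionsRep ι K ρ) ξ ∧
      ∀ g, ζ.1 g = 0 ∨ ζ.1 g = orbitSum ι K (DoubleCoset.mk ι.range K g) ξ.1 := by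
  classical
  have hfin := finite_support_out hK ξ.2.1
  -- Each value of `ξ` is moved to the chosen coset of its double coset. There the values add up to
  -- the orbit sum; on every other coset the new function vanishes.
  let r : G ⧸ K → G := fun x => Quotient.out (DoubleCoset.mk ι.range K x.out)
  refine ⟨∑ x ∈ hfin.toFinset, cosetSingle hKc (r x) (ξ.1 x.out), ?_, fun g => ?_⟩
  · conv_rhs => rw [← sum_cosetSingle hK hKc ξ]
    rw [map_sum, map_sum]
    exact Finset.sum_congr rfl fun x _ =>
      coinvariants_mk_cosetSingle hKc hρ (DoubleCoset.out_eq' _ K _) _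
  · rw [Submodule.coe_sum, Finset.sum_apply]
    by_cases hg : (QuotientGroup.mk g : G ⧸ K) =
        QuotientGroup.mk (Quotient.out (DoubleCoset.mk ι.range K g))
    · right
      rw [orbitSum, finsum_mem_eq_sum_filter _ _ hfin, Finset.sum_filter]
      refine Finset.sum_congr rfl fun x _ => if_congr ?_ rfl rfl
      constructor
      · intro h
        have h1 := congrArg (fun x : G ⧸ K => DoubleCoset.mk ι.range K x.out) h
        simp only [doubleCoset_mk_out] at h1
        exact (h1.trans (DoubleCoset.out_eq' _ K _)).symm
      · intro h
        rw [hg, ← show DoubleCoset.mk ι.range K x.out = DoubleCoset.mk ι.range K g from h]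
    · left
      refine Finset.sum_eq_zero fun x _ => if_neg fun h => hg ?_
      have h1 := congrArg (fun x : G ⧸ K => DoubleCoset.mk ι.range K x.out) h
      simp only [doubleCoset_mk_out] at h1
      rw [h1.trans (DoubleCoset.out_eq' _ K _)]
      exact h

end Coinvariants
end ZetaElement

namespace ZetaElement

/-! ### Integrality for the trivial functor. -/

section Integrality

variable {G H : Type*} [Group G] [TopologicalSpace G] [Group H] [TopologicalSpace H]
  [IsTopologicalGroup H] [LocallyCompactSpace H]
  {O : Type*} [CommRing O] {ΥH : LevelFamily H} {Φ : Type*} [Field Φ] [CharZero Φ] [Algebra O Φ]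

/-- For the trivial functor, `O`-integrality at level `L` says that the value at `g` is an
`O`-multiple of `[U : H ∩ g L g⁻¹]`. -/
theorem isIntegralAt_trivialFunctor_iff (ι : H →* G) (U : ΥH.Level) {K L : Subgroup G}
    (hL : ∀ g : G, (MulAut.conj g • L).comap ι ∈ ΥH.carrier)
    (ξ : cosetFunctions Φ K ((trivialFunctor O ΥH).baseChange Φ).Completion) :
    IsIntegralAt ι (trivialFunctor O ΥH) Φ U L ξ ↔
      ∀ g : G, trivialEval ΥH Φ (ξ.1 g) ∈
        Submodule.span O {(genIndex U.1 ((MulAut.conj g • L).comap ι) : Φ)} := by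
  refine forall_congr' fun g => ?_
  constructor
  · rintro ⟨n, V, x, hV, hx⟩
    rw [hx, map_sum]
    refine Submodule.sum_mem _ fun i _ => ?_
    -- Since `V i ≤ V_g`, the coefficient `[U : V i]` equals `[U : V_g]` times the integer `[V_g : V
    -- i]`.
    obtain ⟨a, ha⟩ : ∃ a : O, trivialEval ΥH Φ
        (toCompletionOver (trivialFunctor O ΥH) Φ (V i) (x i)) = algebraMap O Φ a :=
      ⟨x i, trivialEval_toCompletionOver (O := O) ΥH Φ (V i) (x i)⟩
    rw [map_smul, ha, Submodule.mem_span_singleton,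
      genIndex_mul_relIndex (ΥH.isOpen _ U.2) (ΥH.isCompact _ U.2) (ΥH.isOpen _ (hL g))
        (ΥH.isCompact _ (hL g)) (ΥH.isOpen _ (V i).2) (ΥH.isCompact _ (V i).2) (hV i)]
    refine ⟨(((V i).1.relIndex ((MulAut.conj g • L).comap ι) : ℕ) : O) * a, ?_⟩
    rw [Algebra.smul_def, map_mul, map_natCast, Rat.cast_mul, Rat.cast_natCast, smul_eq_mul]
    ring
  · intro h
    obtain ⟨a, ha⟩ := Submodule.mem_span_singleton.1 h
    -- Conversely a single term at the largest allowed level `V_g` suffices.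
    refine ⟨1, fun _ => ⟨_, hL g⟩, fun _ => a, fun _ => le_rfl, trivialEval_injective ΥH Φ ?_⟩
    rw [map_sum, Fin.sum_univ_one, map_smul, trivialEval_toCompletionOver, ← ha,
      Algebra.smul_def, smul_eq_mul, mul_comm]

end Integrality

/-! ### Dependence of the indices on the double coset. -/

section Conjugation

variable {G H : Type*} [Group G] [Group H]

theorem conj_mem_iff_of_normal {K L : Subgroup G} (hLK : L ≤ K) (hn : (L.subgroupOf K).Normal)
    {k : G} (hk : k ∈ K) (x : G) : k⁻¹ * x * k ∈ L ↔ x ∈ L := by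
  have h := (Subgroup.normal_subgroupOf_iff hLK).1 hn
  constructor
  · intro hx
    simpa [mul_assoc] using h _ _ hx hk
  · intro hx
    simpa [mul_assoc] using h _ _ hx (inv_mem hk)

/-- `[U : H ∩ g L g⁻¹]` depends only on the double coset `H g K`. -/
theorem genIndex_comap_conj_eq [TopologicalSpace H] [IsTopologicalGroup H]
    [LocallyCompactSpace H] (hH : IsUnimodular H) {ι : H →* G} {ΥH : LevelFamily H}
    {U : Subgroup H} (hU : U ∈ ΥH.carrier) {K L : Subgroup G} (hLK : L ≤ K)
    (hn : (L.subgroupOf K).Normal)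
    (hL : ∀ g : G, (MulAut.conj g • L).comap ι ∈ ΥH.carrier) {g g' : G}
    (hg : DoubleCoset.mk ι.range K g = DoubleCoset.mk ι.range K g') :
    genIndex U ((MulAut.conj g' • L).comap ι) = genIndex U ((MulAut.conj g • L).comap ι) := by
  -- Normality of `L` in `K` absorbs `k`, so passing from `g` to `h g k` only conjugates the
  -- subgroup by `h`, which preserves volume.
  obtain ⟨_, ⟨h, rfl⟩, k, hk, rfl⟩ := (DoubleCoset.eq _ K _ _).1 hg
  refine genIndex_conj hH (ΥH.isOpen _ hU) (ΥH.isCompact _ hU) (ΥH.isOpen _ (hL g))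
    (ΥH.isCompact _ (hL g)) h (ΥH.isOpen _ (hL _)) (ΥH.isCompact _ (hL _)) fun x => ?_
  rw [mem_comap_conj_smul, mem_comap_conj_smul,
    ← conj_mem_iff_of_normal hLK hn hk (g⁻¹ * ι (h⁻¹ * x * h) * g)]
  simp [mul_assoc]

end Conjugation

/-! ### Orbit sums of the tensor element as degrees. -/

section Degree

variable {G H : Type*} [Group G] [TopologicalSpace G] [IsTopologicalGroup G]
  [Group H] [TopologicalSpace H] [IsTopologicalGroup H] [LocallyCompactSpace H]
  {O : Type*} [CommRing O] {ΥH : LevelFamily H} {Φ : Type*} [Field Φ] [CharZero Φ] [Algebra O Φ]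

omit [IsTopologicalGroup H] [LocallyCompactSpace H] [CharZero Φ] in
theorem trivialEval_orbitSum {ι : H →* G} {K : Subgroup G} (hK : IsOpen (K : Set G))
    (D : DoubleCoset.Quotient (ι.range : Set G) (K : Set G))
    (ξ : cosetFunctions Φ K ((trivialFunctor O ΥH).baseChange Φ).Completion) :
    trivialEval ΥH Φ (orbitSum ι K D ξ.1) =
      orbitSum ι K D fun g => trivialEval ΥH Φ (ξ.1 g) :=
  (trivialEval ΥH Φ).toAddMonoidHom.map_finsum_mem' (f := fun x : G ⧸ K => ξ.1 x.out)
    ((finite_support_out hK ξ.2.1).inter_of_right _)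

/-- The sum of `j_U(x_U) ⊗ P` over `H g K` is `[U : H_g] deg(𝔥_g^t) x_U`. -/
theorem trivialEval_orbitSum_tensorElement (hH : IsUnimodular H) {ι : H →* G}
    (hι : Topology.IsClosedEmbedding ι) {K : Subgroup G} (hK : IsOpen (K : Set G))
    (hKι : ∀ g : G, (MulAut.conj g • K).comap ι ∈ ΥH.carrier)
    (hU : K.comap ι ∈ ΥH.carrier) (P : heckeSpace O K K) (x : O) (g : G) :
    trivialEval ΥH Φ (orbitSum ι K (DoubleCoset.mk ι.range K g)
        (tensorElement (toCompletionOver (trivialFunctor O ΥH) Φ ⟨K.comap ι, hU⟩ x) P :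
          cosetFunctions Φ K ((trivialFunctor O ΥH).baseChange Φ).Completion).1) =
      genIndex (K.comap ι) ((MulAut.conj g • K).comap ι) *
        algebraMap O Φ (x * degree (transpose (twistedRestriction ι hι P g))) := by
  set f := twistedRestriction ι hι P g with hf
  have hfΦ : HasCompactSupport fun h => algebraMap O Φ (f.1 h) :=
    f.2.1.comp_left (g := algebraMap O Φ) (map_zero _)
  have hUo := ΥH.isOpen _ hU
  -- The orbit sum runs over `H/H_g`, whereas the degree of the transpose runs over `H/U`; this
  -- identity links them.
  have hsum := finsum_eq_genIndex_mul_finsum_inv hH hUo (ΥH.isCompact _ hU)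
    (ΥH.isOpen _ (hKι g)) (ΥH.isCompact _ (hKι g)) hfΦ
    (fun k hk a => congrArg _ (by simpa using f.2.2 k hk 1 (one_mem _) a))
    (fun k hk a => congrArg _ (by simpa using f.2.2 1 (one_mem _) k hk a))
  have hdeg : algebraMap O Φ (degree (transpose f)) =
      ∑ᶠ y : H ⧸ K.comap ι, algebraMap O Φ (f.1 y.out⁻¹) := by
    rw [degree_eq_finsum hUo]
    exact (algebraMap O Φ).toAddMonoidHom.map_finsum (finite_support_out hUo (transpose f).2.1)
  rw [trivialEval_orbitSum hK, orbitSum_mk]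
  · have hval : ∀ y : H ⧸ (MulAut.conj g • K).comap ι, trivialEval ΥH Φ
        ((tensorElement (toCompletionOver (trivialFunctor O ΥH) Φ ⟨K.comap ι, hU⟩ x) P :
          cosetFunctions Φ K ((trivialFunctor O ΥH).baseChange Φ).Completion).1
            (ι y.out * g)) = algebraMap O Φ x * algebraMap O Φ (f.1 y.out) := fun y => by
      refine (map_smul (trivialEval ΥH Φ) _ _).trans ?_
      rw [trivialEval_toCompletionOver, smul_eq_mul, mul_comm]
      rfl
    rw [finsum_congr hval, ← mul_finsum, hsum, ← hdeg, map_mul]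
    ring
  · intro k hk a
    exact congrArg (trivialEval ΥH Φ) ((tensorElement _ P).2.2 k hk a)

/-- The sum of `j_U(x_U) ⊗ P` over `H g K` is an `O`-multiple of `[U : V_g]` if and only if
the degree of `𝔥_g^t` is divisible by `d_g = [H_g : V_g]`. -/
theorem trivialEval_orbitSum_tensorElement_mem_iff (hH : IsUnimodular H) {ι : H →* G}
    (hι : Topology.IsClosedEmbedding ι) {K L : Subgroup G} (hK : IsOpen (K : Set G))
    (hLK : L ≤ K) (hKι : ∀ g : G, (MulAut.conj g • K).comap ι ∈ ΥH.carrier)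
    (hLι : ∀ g : G, (MulAut.conj g • L).comap ι ∈ ΥH.carrier)
    (hU : K.comap ι ∈ ΥH.carrier) (hΦ : Function.Injective (algebraMap O Φ))
    (P : heckeSpace O K K) {x : O} (hx : IsUnit x) (g : G) :
    trivialEval ΥH Φ (orbitSum ι K (DoubleCoset.mk ι.range K g)
        (tensorElement (toCompletionOver (trivialFunctor O ΥH) Φ ⟨K.comap ι, hU⟩ x) P :
          cosetFunctions Φ K ((trivialFunctor O ΥH).baseChange Φ).Completion).1) ∈
        Submodule.span O {(genIndex (K.comap ι) ((MulAut.conj g • L).comap ι) : Φ)} ↔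
      degree (transpose (twistedRestriction ι hι P g)) ∈
        Ideal.span {((((MulAut.conj g • L).comap ι).relIndex
          ((MulAut.conj g • K).comap ι) : ℕ) : O)} := by
  have hne : (genIndex (K.comap ι) ((MulAut.conj g • K).comap ι) : Φ) ≠ 0 :=
    Rat.cast_ne_zero.2 (genIndex_ne_zero (ΥH.isOpen _ hU) (ΥH.isCompact _ hU)
      (ΥH.isOpen _ (hKι g)) (ΥH.isCompact _ (hKι g)))
  rw [trivialEval_orbitSum_tensorElement hH hι hK hKι hU, ← Ideal.unit_mul_mem_iff_mem _ hx,
    genIndex_mul_relIndex (ΥH.isOpen _ hU) (ΥH.isCompact _ hU) (ΥH.isOpen _ (hKι g))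
      (ΥH.isCompact _ (hKι g)) (ΥH.isOpen _ (hLι g)) (ΥH.isCompact _ (hLι g))
      (Subgroup.comap_mono (Subgroup.pointwise_smul_le_pointwise_smul_iff.2 hLK)),
    Submodule.mem_span_singleton, Ideal.mem_span_singleton']
  refine exists_congr fun a => ?_
  -- The common factor `[U : H_g]` cancels in `Φ`, and the remaining equation descends to `O` by
  -- injectivity.
  rw [Algebra.smul_def, Rat.cast_mul, Rat.cast_natCast, mul_left_comm, mul_right_inj' hne,
    ← map_natCast (algebraMap O Φ), ← map_mul, hΦ.eq_iff]

end Degree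

end ZetaElement

/-- For a domain, having a `ℚ`-algebra as fraction field amounts to characteristic zero, hence
`CharZero O`. -/
theorem corollary3p12
    {G H : Type*}
    [Group G] [TopologicalSpace G] [ZetaElement.LocallyProfinite G]
    [Group H] [TopologicalSpace H] [ZetaElement.LocallyProfinite H]
    (hG : ZetaElement.IsUnimodular G) (hH : ZetaElement.IsUnimodular H)
    (ι : H →* G) (hι : Topology.IsClosedEmbedding ι)
    (ΥG : ZetaElement.LevelFamily G) (ΥH : ZetaElement.LevelFamily H)
    (hΥ : ∀ K ∈ ΥG.carrier, K.comap ι ∈ ΥH.carrier)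
    {O : Type*} [CommRing O] [IsDomain O] [CharZero O]
    (Φ : Type*) [Field Φ] [Algebra O Φ] (hΦ : Function.Injective (algebraMap O Φ))
    (K L : Subgroup G) (hK : K ∈ ΥG.carrier) (hL : L ∈ ΥG.carrier)
    (hLK : L ≤ K) (hnormal : (L.subgroupOf K).Normal)
    (P : ZetaElement.heckeSpace O K K) (hP : P ≠ 0)
    (xU : O) (hxU : IsUnit xU)
    (rep : ZetaElement.supportDoubleCosets ι P → G)
    (hrep : ∀ α, DoubleCoset.mk ι.range K (rep α) = α.1) :
    (∃ ζ, ZetaElement.IsZetaElement ι (ZetaElement.trivialFunctor O ΥH) Φ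
        ⟨K.comap ι, hΥ K hK⟩ xU P L ζ) ↔
      ∀ α : ZetaElement.supportDoubleCosets ι P,
        ZetaElement.degree
            (ZetaElement.transpose (ZetaElement.twistedRestriction ι hι P (rep α))) ∈
          Ideal.span {((((MulAut.conj (rep α) • L).comap ι).relIndex
            ((MulAut.conj (rep α) • K).comap ι) : ℕ) : O)} := by
  have : CharZero Φ := charZero_of_injective_algebraMap hΦ
  have hKo := ΥG.isOpen K hK
  have hKι : ∀ g : G, (MulAut.conj g • K).comap ι ∈ ΥH.carrier := fun g =>
    hΥ _ (ΥG.conj_mem g K hK)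
  have hLι : ∀ g : G, (MulAut.conj g • L).comap ι ∈ ΥH.carrier := fun g =>
    hΥ _ (ΥG.conj_mem g L hL)
  have hcrit := ZetaElement.trivialEval_orbitSum_tensorElement_mem_iff hH hι hKo hLK hKι hLι
    (hΥ K hK) hΦ P hxU
  have hindex : ∀ {g g' : G}, DoubleCoset.mk ι.range K g = DoubleCoset.mk ι.range K g' →
      ZetaElement.genIndex (K.comap ι) ((MulAut.conj g' • L).comap ι) =
        ZetaElement.genIndex (K.comap ι) ((MulAut.conj g • L).comap ι) :=
    ZetaElement.genIndex_comap_conj_eq hH (hΥ K hK) hLK hnormal hLι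
  have htriv := ZetaElement.completionRep_trivialFunctor_apply (O := O) ΥH Φ
  constructor
  · rintro ⟨ζ, hint, hcoinv⟩ α
    rw [ZetaElement.isIntegralAt_trivialFunctor_iff ι _ hLι] at hint
    rw [← hcrit, ← ZetaElement.orbitSum_eq_of_coinvariants_eq hKo htriv hcoinv,
      ZetaElement.trivialEval_orbitSum hKo]
    -- All values of `ζ` on one double coset lie in the same submodule, so their sum does too.
    refine ZetaElement.orbitSum_mem _ fun g hg => ?_
    rw [hindex hg]
    exact hint g
  · intro h
    obtain ⟨ζ, hζ, hval⟩ := ZetaElement.exists_coinvariants_eq_orbitSum hKo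
      (ΥG.isCompact K hK) htriv
      (ZetaElement.tensorElement (ZetaElement.toCompletionOver (ZetaElement.trivialFunctor O ΥH) Φ
        ⟨K.comap ι, hΥ K hK⟩ xU) P)
    refine ⟨ζ, (ZetaElement.isIntegralAt_trivialFunctor_iff ι _ hLι ζ).2 fun g => ?_, hζ⟩
    rcases hval g with h0 | h1
    · rw [h0, map_zero]
      exact zero_mem _
    rw [h1]
    by_cases hg : DoubleCoset.mk ι.range K g ∈ ZetaElement.supportDoubleCosets ι P
    · have hα := hrep ⟨_, hg⟩
      have := (hcrit _).2 (h ⟨_, hg⟩)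
      rw [hα, ← hindex hα] at this
      exact this
    -- A double coset missing the support of `P` has orbit sum zero, so it imposes no condition.
    · rw [ZetaElement.trivialEval_orbitSum hKo]
      refine ZetaElement.orbitSum_mem _ fun a ha => ?_
      have hPa : P.1 a = 0 := by
        by_contra hne
        exact hg ⟨a, hne, ha⟩
      simp [ZetaElement.tensorElement, hPa]
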